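/- Let $\omega=\{0,1,2,\dots\}$, let $c,h\in\omega^\omega$ with $c(i)\ge 1$ for all $i$ and $h(i)\ge 1$ for all but finitely many $i$, and identify $c(i)$ with the set $\{0,\dots,c(i)-1\}$. Let $\prod c:=\prod_{i<\omega}c(i)$ and let $\mathcal S(c,h)$ be the set of all sequences $\varphi=\langle\varphi(i)\mid i<\omega\rangle$ with $\varphi(i)\subseteq c(i)$ and $|\varphi(i)|\le h(i)$ for all $i$. For $y\in\prod c$ and $\varphi\in\mathcal S(c,h)$ write $y\notin^\infty\varphi$ if $y(i)\notin\varphi(i)$ for all but finitely many $i$. Put $$\mathfrak v^\exists_{c,h}:=\min\{|E| : E\subseteq\textstyle\prod c,\ \forall\varphi\in\mathcal S(c,h)\ \exists y\in E:\ y\notin^\infty\varphi\},$$ $$\mathfrak c^\exists_{c,h}:=\min\{|R| : R\subseteq\mathcal S(c,h),\ \neg\exists y\in\textstyle\prod c\ \forall\varphi\in R:\ y\notin^\infty\varphi\},$$ where $\min\emptyset:=\infty$, which is larger than every cardinal. Let $\mathcal N$ be the ideal of subsets of $2^\omega$ of Lebesgue (i.e. fair coin tossing) measure zero, let $\operatorname{cov}(\mathcal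 N)$ be the least size of a subfamily of $\mathcal N$ whose union is $2^\omega$, and let $\operatorname{non}(\mathcal N)$ be the least size of a subset of $2^\omega$ that is not in $\mathcal N$. A relational system is a triple $\mathbf R=\langle X,Y,\sqsubset\rangle$ with ${\sqsubset}\subseteq X\times Y$; its dual is $\mathbf R^\perp:=\langle Y,X,\sqsubset^\perp\rangle$, where $y\sqsubset^\perp x$ means that $x\sqsubset y$ fails. Write $\mathbf R\preceq_T\mathbf R'=\langle X',Y',\sqsubset'\rangle$ if there are maps $F:X\to X'$ and $G:Y'\to Y$ such that, for all $x\in X$ and $y'\in Y'$, $F(x)\sqsubset' y'$ implies $x\sqsubset G(y')$. Let $\mathbf{Cv}(\mathcal N):=\langle 2^\omega,\mathcal N,\in\rangle$, and let $\mathbf{aLc}(c,h):=\langle\mathcal S(c,h),\prod c,\sqsubset\rangle$, where $\varphi\sqsubset y$ means $y\notin^\infty\varphi$. (a) If $\sum_{i<\omega}\frac{h(i)}{c(i)}<\infty$, then $\mathbf{Cv}(\mathcal N)\preceq_T\mathbf{aLc}(c,h)^\perp$; moreover $\operatorname{cov}(\mathcal N)\le\mathfrak c^\exists_{c,h}$ and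 $\mathfrak v^\exists_{c,h}\le\operatorname{non}(\mathcal N)$. (b) If $\sum_{i<\omega}\frac{h(i)}{c(i)}=\infty$, then $\mathbf{Cv}(\mathcal N)\preceq_T\mathbf{aLc}(c,h)$; moreover $\operatorname{cov}(\mathcal N)\le\mathfrak v^\exists_{c,h}$ and $\mathfrak c^\exists_{c,h}\le\operatorname{non}(\mathcal N)$. -/

import Mathlib

open Filter MeasureTheory
open scoped ENNReal Cardinal

universe u v

noncomputable section

/-- A relational system `⟨X, Y, ⊏⟩`. -/
structure RelSystem where
  X : Type u
  Y : Type u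
  rel : X → Y → Prop

namespace RelSystem

/-- The dual relational system `R^⊥ = ⟨Y, X, R'⟩`, where `R' y x` says that `x ⊏ y` fails. -/
def dual (R : RelSystem.{u}) : RelSystem.{u} where
  X := R.Y
  Y := R.X
  rel y x := ¬ R.rel x y

/-- `(F, G)` is a Tukey connection from `R` to `R'`. -/
def IsTukeyConnection (R : RelSystem.{u}) (R' : RelSystem.{v}) (F : R.X → R'.X) (G : R'.Y → R.Y) :
    Prop :=
  ∀ (x : R.X) (y' : R'.Y), R'.rel (F x) y' → R.rel x (G y')

/-- `R` is Tukey-below `R'`. -/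
def TukeyLE (R : RelSystem.{u}) (R' : RelSystem.{v}) : Prop :=
  ∃ (F : R.X → R'.X) (G : R'.Y → R.Y), IsTukeyConnection R R' F G

end RelSystem

/-- The least cardinality of a set with property `P`, with the convention `min ∅ = ∞`. -/
def minCard {α : Type u} (P : Set α → Prop) : WithTop Cardinal.{u} :=
  sInf {κ | ∃ S : Set α, P S ∧ κ = ((#S : Cardinal.{u}) : WithTop Cardinal.{u})}

/-- `Cv(I) = ⟨X, I, ∈⟩` for a family `I` of subsets of `X`. -/
def Cv {X : Type u} (I : Set (Set X)) : RelSystem.{u} where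
  X := X
  Y := I
  rel x A := x ∈ A.1

/-- The covering number: the least size of a subfamily of `I` that covers `X`. -/
def covNum {X : Type u} (I : Set (Set X)) : WithTop Cardinal.{u} :=
  minCard fun F : Set (Set X) => F ⊆ I ∧ ⋃₀ F = Set.univ

/-- The uniformity number: the least size of a subset of `X` that is not in `I`. -/
def nonNum {X : Type u} (I : Set (Set X)) : WithTop Cardinal.{u} :=
  minCard fun A : Set X => A ∉ I

/-- Lebesgue (fair coin tossing) measure on `2^ω`. -/
def cantorMeasure : Measure (ℕ → Bool) :=
  Measure.infinitePi fun _ => (PMF.uniformOfFintype Bool).toMeasure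

/-- The ideal `𝒩` of measure zero subsets of `2^ω`; the sets need not be measurable
(a `Measure` is applied to arbitrary sets as an outer measure). -/
def nullIdeal : Set (Set (ℕ → Bool)) :=
  {A | cantorMeasure A = 0}

/-- `S(C, h)`: the `h`-slaloms, i.e. sequences of subsets of `C i` of size at most `h i`. -/
def Slalom (C : ℕ → Type u) (h : ℕ → ℕ) : Type u :=
  ∀ i, {s : Finset (C i) // s.card ≤ h i}

/-- `φ` anti-localises `y`: for all but finitely many `i`, `y i ∉ φ i`. -/
def AntiLocalises {C : ℕ → Type u} {h : ℕ → ℕ} (φ : Slalom C h) (y : ∀ i, C i) : Prop :=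
  ∀ᶠ i in atTop, y i ∉ (φ i).1

/-- `aLc(C, h)`: the slaloms against `∏ C`, with the anti-localisation relation. -/
def aLc (C : ℕ → Type u) (h : ℕ → ℕ) : RelSystem.{u} where
  X := Slalom C h
  Y := ∀ i, C i
  rel φ y := AntiLocalises φ y

/-- The anti-localisation cardinal `𝔳^∃_{C,h}`. -/
def vExists (C : ℕ → Type u) (h : ℕ → ℕ) : WithTop Cardinal.{u} :=
  minCard fun E : Set (∀ i, C i) => ∀ φ : Slalom C h, ∃ y ∈ E, AntiLocalises φ y

/-- The anti-localisation cardinal `𝔠^∃_{C,h}`. -/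
def cExists (C : ℕ → Type u) (h : ℕ → ℕ) : WithTop Cardinal.{u} :=
  minCard fun R : Set (Slalom C h) => ¬ ∃ y : ∀ i, C i, ∀ φ ∈ R, AntiLocalises φ y

/-- For `c ∈ ω^ω`, the sequence of sets `c(i) = {0, …, c(i) - 1}`. -/
abbrev finSeq (c : ℕ → ℕ) : ℕ → Type :=
  fun i => Fin (c i)

end

/-! Disjoint blocks of coin tosses define a map `T` from `2^ω` to `∏ c` that carries the coin
measure to a product of measures uniform up to a factor 2; this factor does not affect convergence
of series. If `∑ h/c` converges, the first Borel–Cantelli lemma makes `{x | T x i ∈ φ i infinitely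
often}` null for each slalom `φ`, which gives (a). If it diverges, `T x` is turned into a slalom of
cyclic intervals of length `h i` starting at `T x i`. For fixed `y` the events that `y i` is caught
are independent with divergent probability sum, so by the second Borel–Cantelli lemma almost every
`x` catches `y` infinitely often, which gives (b). The cardinal inequalities follow formally from
the Tukey connections. -/

theorem minCard_le {α : Type u} {P : Set α → Prop} {S : Set α} (hS : P S) :
    minCard P ≤ ((#S : Cardinal.{u}) : WithTop Cardinal.{u}) :=
  sInf_le ⟨S, hS, rfl⟩

section Tukey

variable {X : Type u} {I : Set (Set X)} {R : RelSystem.{u}}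

theorem covNum_le_of_tukeyLE (hR : RelSystem.TukeyLE (Cv I) R) :
    covNum I ≤ minCard fun D : Set R.Y => ∀ x, ∃ y ∈ D, R.rel x y := by
  obtain ⟨F, G, hFG⟩ := hR
  refine le_sInf ?_
  rintro _ ⟨D, hD, rfl⟩
  refine (minCard_le (S := (fun y => (G y).1) '' D) ⟨?_, ?_⟩).trans
    (WithTop.coe_le_coe.2 Cardinal.mk_image_le)
  · rintro _ ⟨y, -, rfl⟩
    exact (G y).2
  · refine Set.eq_univ_of_forall fun x => ?_
    obtain ⟨y, hy, hxy⟩ := hD (F x)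
    exact ⟨_, ⟨y, hy, rfl⟩, hFG x y hxy⟩

theorem le_nonNum_of_tukeyLE (hI : ∀ A ∈ I, ∀ B ⊆ A, B ∈ I)
    (hR : RelSystem.TukeyLE (Cv I) R) :
    (minCard fun B : Set R.X => ¬ ∃ y, ∀ x ∈ B, R.rel x y) ≤ nonNum I := by
  obtain ⟨F, G, hFG⟩ := hR
  refine le_sInf ?_
  rintro _ ⟨A, hA, rfl⟩
  refine (minCard_le (S := F '' A) ?_).trans
    (WithTop.coe_le_coe.2 Cardinal.mk_image_le)
  rintro ⟨y, hy⟩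
  exact hA (hI _ (G y).2 A fun x hx => hFG x y (hy _ ⟨x, hx, rfl⟩))

end Tukey

/-- Reducing modulo `c` maps a finite set with at least `c` elements onto `Fin c` in such a way that
each fibre has the average size, up to a factor of `2`. -/
theorem exists_balanced_map (α : Type*) [Fintype α] {c : ℕ} (hc : 1 ≤ c)
    (hα : c ≤ Fintype.card α) :
    ∃ e : α → Fin c, ∀ a, c * (Finset.univ.filter fun x => e x = a).card ≤ 2 * Fintype.card α ∧
      Fintype.card α ≤ 2 * (c * (Finset.univ.filter fun x => e x = a).card) := by
  classical
  set N := Fintype.card α with hN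
  let f := Fintype.equivFin α
  refine ⟨fun x => ⟨f x % c, Nat.mod_lt _ hc⟩, fun a => ?_⟩
  have hcard : (Finset.univ.filter fun x => (⟨f x % c, Nat.mod_lt _ hc⟩ : Fin c) = a).card
      = N.count (· ≡ a [MOD c]) := by
    rw [Nat.count_eq_card_filter_range]
    refine Finset.card_bij (fun x _ => (f x : ℕ)) ?_ ?_ ?_
    · intro x hx
      have hx' := congrArg Fin.val (Finset.mem_filter.1 hx).2
      simp only [Finset.mem_filter, Finset.mem_range]
      refine ⟨(f x).2, ?_⟩
      simpa [Nat.ModEq, Nat.mod_eq_of_lt a.2] using hx'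
    · intro x _ y _ hxy
      exact f.injective (Fin.ext hxy)
    · intro n hn
      simp only [Finset.mem_filter, Finset.mem_range] at hn
      refine ⟨f.symm ⟨n, hn.1⟩, ?_, by simp⟩
      have := hn.2
      simp only [Nat.ModEq, Nat.mod_eq_of_lt a.2] at this
      simp [Fin.ext_iff, this]
  rw [hcard, Nat.count_modEq_card _ hc]
  have h1 := Nat.div_add_mod N c
  have h2 := Nat.mod_lt N hc
  have h3 : 1 ≤ N / c := (Nat.one_le_div_iff hc).2 hα
  have h4 : c ≤ c * (N / c) := Nat.le_mul_of_pos_right _ h3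
  -- With `q = N / c ≥ 1`, each fibre has size `q` or `q + 1`, and `c * q ≤ N < c * (q + 1) ≤ 2 * (c
  -- * q)`.
  split_ifs <;> constructor <;> simp only [mul_add, mul_one, add_zero] <;> omega

/-- A measure on `Fin c` whose point masses agree with `1 / c` up to a factor of `2`. -/
def IsNearlyUniform {c : ℕ} (ν : Measure (Fin c)) : Prop :=
  ∀ a, (c : ℝ≥0∞) * ν {a} ≤ 2 ∧ 1 ≤ 2 * (c * ν {a})

theorem IsNearlyUniform.mul_measure_le {c : ℕ} {ν : Measure (Fin c)} (hν : IsNearlyUniform ν)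
    (s : Finset (Fin c)) : c * ν s ≤ 2 * s.card := by
  rw [← sum_measure_singleton, Finset.mul_sum]
  calc _ ≤ ∑ _a ∈ s, (2 : ℝ≥0∞) := Finset.sum_le_sum fun a _ => (hν a).1
    _ = _ := by simp [mul_comm]

theorem IsNearlyUniform.card_le {c : ℕ} {ν : Measure (Fin c)} (hν : IsNearlyUniform ν)
    (s : Finset (Fin c)) : (s.card : ℝ≥0∞) ≤ 2 * (c * ν s) := by
  rw [← sum_measure_singleton, Finset.mul_sum, Finset.mul_sum]
  calc _ = ∑ _a ∈ s, (1 : ℝ≥0∞) := by simp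
    _ ≤ _ := Finset.sum_le_sum fun a _ => (hν a).2

theorem infinitePi_coin_apply {ι : Type*} [Fintype ι] [DecidableEq ι] (s : Finset (ι → Bool)) :
    (Fintype.card (ι → Bool) : ℝ≥0∞) *
      Measure.infinitePi (fun _ : ι => (PMF.uniformOfFintype Bool).toMeasure) s = s.card := by
  rw [← sum_measure_singleton]
  have h : ∀ x : ι → Bool,
      Measure.infinitePi (fun _ : ι => (PMF.uniformOfFintype Bool).toMeasure) {x}
        = (Fintype.card (ι → Bool) : ℝ≥0∞)⁻¹ := by
    intro x
    rw [Measure.infinitePi_eq_pi, Measure.pi_singleton]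
    simp [ENNReal.inv_pow]
  simp only [h, Finset.sum_const, nsmul_eq_mul]
  rw [mul_left_comm, ENNReal.mul_inv_cancel (by simp) (by simp), mul_one]

theorem exists_isNearlyUniform_map {c : ℕ} (hc : 1 ≤ c) :
    ∃ e : (Fin c → Bool) → Fin c, IsNearlyUniform
      ((Measure.infinitePi fun _ : Fin c => (PMF.uniformOfFintype Bool).toMeasure).map e) := by
  obtain ⟨e, he⟩ := exists_balanced_map (Fin c → Bool) hc
    -- A block of `c` tosses suffices because `c ≤ 2 ^ c`.
    (by simpa using Nat.lt_two_pow_self.le)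
  refine ⟨e, fun a => ?_⟩
  rw [Measure.map_apply (measurable_of_finite e) (measurableSet_singleton a)]
  have hpre : e ⁻¹' {a} = ((Finset.univ.filter fun x => e x = a : Finset _) : Set _) := by
    ext; simp
  have hμ := infinitePi_coin_apply (Finset.univ.filter fun x => e x = a)
  rw [← hpre] at hμ
  obtain ⟨h1, h2⟩ := he a
  set m := Measure.infinitePi (fun _ : Fin c => (PMF.uniformOfFintype Bool).toMeasure) (e ⁻¹' {a})
  set N := Fintype.card (Fin c → Bool)
  have hN0 : (N : ℝ≥0∞) ≠ 0 := by simp [N]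
  have hNt : (N : ℝ≥0∞) ≠ ∞ := by simp
  constructor
  · rw [← ENNReal.mul_le_mul_iff_right hN0 hNt]
    calc (N : ℝ≥0∞) * (c * m) = c * (N * m) := by ring
      _ ≤ N * 2 := by rw [hμ, mul_comm (N : ℝ≥0∞)]; exact_mod_cast h1
  · rw [← ENNReal.mul_le_mul_iff_right hN0 hNt]
    calc (N : ℝ≥0∞) * 1 ≤ 2 * (c * (N * m)) := by rw [hμ, mul_one]; exact_mod_cast h2
      _ = N * (2 * (c * m)) := by ring

/-- Disjoint blocks of coin tosses yield independent, nearly uniformly distributed elements of the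
sets `c i`. -/
theorem exists_map_cantorMeasure_eq_infinitePi {c : ℕ → ℕ} (hc : ∀ i, 1 ≤ c i) :
    ∃ (T : (ℕ → Bool) → ∀ i, Fin (c i)) (ν : ∀ i, Measure (Fin (c i))), Measurable T ∧
      (∀ i, IsProbabilityMeasure (ν i)) ∧ (∀ i, IsNearlyUniform (ν i)) ∧
      cantorMeasure.map T = Measure.infinitePi ν := by
  choose e he using fun i => exists_isNearlyUniform_map (hc i)
  have hem : ∀ i, Measurable (e i) := fun i => measurable_of_finite _
  let μ : ∀ i, Measure (Fin (c i) → Bool) := fun i =>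
    Measure.infinitePi fun _ => (PMF.uniformOfFintype Bool).toMeasure
  -- Injectivity of the encoding of pairs `(i, j)` makes the blocks disjoint, hence independent.
  let S : (ℕ → Bool) → ((Σ i, Fin (c i)) → Bool) := fun x p => x (Encodable.encode p)
  let C := MeasurableEquiv.piCurry fun (i : ℕ) (_ : Fin (c i)) => Bool
  let E : (∀ i, Fin (c i) → Bool) → ∀ i, Fin (c i) := fun z i => e i (z i)
  have hS : Measurable S := by fun_prop
  have hE : Measurable E := by fun_prop
  refine ⟨E ∘ C ∘ S, fun i => (μ i).map (e i), hE.comp (C.measurable.comp hS),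
    fun i => Measure.isProbabilityMeasure_map (hem i).aemeasurable, he, ?_⟩
  rw [← Measure.map_map hE (C.measurable.comp hS), ← Measure.map_map C.measurable hS,
    cantorMeasure, Measure.map_infinitePi_infinitePi_of_inj Encodable.encode_injective,
    Measure.infinitePi_map_piCurry (fun (i : ℕ) (_ : Fin (c i)) =>
      (PMF.uniformOfFintype Bool).toMeasure)]
  exact Measure.infinitePi_map_pi _ hem

theorem infinitePi_frequently_eq_zero {c : ℕ → ℕ} (hc : ∀ i, 1 ≤ c i)
    {ν : ∀ i, Measure (Fin (c i))} [∀ i, IsProbabilityMeasure (ν i)]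
    (hν : ∀ i, IsNearlyUniform (ν i)) {s : ∀ i, Finset (Fin (c i))}
    (hs : ∑' i, ((s i).card : ℝ≥0∞) / c i ≠ ∞) :
    Measure.infinitePi ν {y | ∃ᶠ i in atTop, y i ∈ s i} = 0 := by
  refine measure_setOfPred_frequently_eq_zero
    (p := fun i (y : ∀ i, Fin (c i)) => y i ∈ s i) ?_
  refine ne_top_of_le_ne_top (ENNReal.mul_ne_top (a := 2) (by simp) hs) ?_
  rw [← ENNReal.tsum_mul_left]
  refine ENNReal.tsum_le_tsum fun i => ?_
  have : Measure.infinitePi ν {y | y i ∈ s i} = ν i (s i) := by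
    rw [← Measure.infinitePi_map_eval ν i, Measure.map_apply (by fun_prop) (by measurability)]
    rfl
  rw [this, ← mul_div_assoc, ENNReal.le_div_iff_mul_le (by simp [Nat.one_le_iff_ne_zero.1 (hc i)])
    (by simp), mul_comm]
  exact (hν i).mul_measure_le _

theorem infinitePi_eventually_eq_zero {c : ℕ → ℕ}
    {ν : ∀ i, Measure (Fin (c i))} [∀ i, IsProbabilityMeasure (ν i)]
    (hν : ∀ i, IsNearlyUniform (ν i)) {s : ∀ i, Finset (Fin (c i))}
    (hs : ∑' i, ((s i).card : ℝ≥0∞) / c i = ∞) :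
    Measure.infinitePi ν {y | ∀ᶠ i in atTop, y i ∉ s i} = 0 := by
  let A : ℕ → Set (∀ i, Fin (c i)) := fun i => {y | y i ∈ s i}
  have hpre : ∀ i, A i = (fun y => y i) ⁻¹' (s i : Set (Fin (c i))) := fun i => rfl
  have hA : ∀ i, MeasurableSet (A i) := fun i =>
    (measurable_pi_apply i) (s i).measurableSet
  have hAν : ∀ i, Measure.infinitePi ν (A i) = ν i (s i) := fun i => by
    rw [hpre, ← Measure.map_apply (by fun_prop) (s i).measurableSet, Measure.infinitePi_map_eval]
  have hind : ProbabilityTheory.iIndepSet A (Measure.infinitePi ν) := by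
    rw [ProbabilityTheory.iIndepSet_iff_meas_biInter hA]
    intro t
    exact (ProbabilityTheory.iIndepFun_infinitePi (P := ν) (X := fun _ y => y)
      fun _ => measurable_id).measure_inter_preimage_eq_mul t
        (sets := fun i => (s i : Set (Fin (c i)))) fun i _ => (s i).measurableSet
  have hsum : ∑' i, Measure.infinitePi ν (A i) = ∞ := by
    have : ∑' i, ((s i).card : ℝ≥0∞) / c i ≤ 2 * ∑' i, Measure.infinitePi ν (A i) := by
      rw [← ENNReal.tsum_mul_left]
      refine ENNReal.tsum_le_tsum fun i => ?_
      rw [hAν]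
      refine ENNReal.div_le_of_le_mul ?_
      calc _ ≤ _ := (hν i).card_le (s i)
        _ = _ := by ring
    rw [hs, top_le_iff] at this
    by_contra h
    exact ENNReal.mul_ne_top ENNReal.ofNat_ne_top h this
  have h1 := ProbabilityTheory.measure_limsup_eq_one hA hind hsum
  have hL : MeasurableSet (limsup A atTop) := MeasurableSet.measurableSet_limsup hA
  have h2 := (prob_compl_eq_zero_iff hL).2 h1
  refine measure_mono_null (fun y hy => ?_) h2
  intro hmem
  rw [mem_limsup_iff_frequently_mem] at hmem
  exact hmem hy

/-- If the truncated series converged, its terms would tend to 0, so truncation would change only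
finitely many terms, all finite. -/
theorem tsum_min_one_eq_top {f : ℕ → ℝ≥0∞} (hf : ∑' i, f i = ∞) (hfin : ∀ i, f i ≠ ∞) :
    ∑' i, min (f i) 1 = ∞ := by
  by_contra h
  have hlt : ∀ᶠ i in atTop, min (f i) 1 < 1 := by
    rw [← Nat.cofinite_eq_atTop]
    exact (ENNReal.tendsto_cofinite_zero_of_tsum_ne_top h).eventually (gt_mem_nhds one_pos)
  obtain ⟨N, hN⟩ := eventually_atTop.1 hlt
  refine absurd hf ?_
  rw [← ENNReal.summable.sum_add_tsum_nat_add' (f := f) (k := N)]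
  refine ENNReal.add_ne_top.2 ⟨ENNReal.sum_ne_top.2 fun i _ => hfin i, ne_top_of_le_ne_top h ?_⟩
  calc ∑' i, f (i + N) = ∑' i, min (f (i + N)) 1 := by
        refine tsum_congr fun i => (min_eq_left ?_).symm
        have := hN (i + N) (Nat.le_add_left _ _)
        rw [min_lt_iff] at this
        exact (this.resolve_right (lt_irrefl _)).le
    _ ≤ ∑' i, min (f i) 1 :=
        ENNReal.tsum_comp_le_tsum_of_injective (add_left_injective N) _

theorem card_filter_equiv_lt {c : ℕ} (n : ℕ) (g : Fin c ≃ Fin c) :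
    (Finset.univ.filter fun a => (g a : ℕ) < n).card = min c n := by
  rw [← Fin.card_filter_val_lt]
  exact Finset.card_equiv g fun a => by simp

/-- The cyclically consecutive elements `r, r + 1, …, r + n - 1` of `Fin c`, as a set of size at
most `n`. -/
def cyclicInterval {c : ℕ} [NeZero c] (n : ℕ) (r : Fin c) : {s : Finset (Fin c) // s.card ≤ n} :=
  ⟨Finset.univ.filter fun a => ((a - r : Fin c) : ℕ) < n,
    (card_filter_equiv_lt n (Equiv.subRight r)).trans_le (min_le_right _ _)⟩

theorem card_filter_mem_cyclicInterval {c : ℕ} [NeZero c] (n : ℕ) (a : Fin c) :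
    (Finset.univ.filter fun r => a ∈ (cyclicInterval n r).1).card = min c n := by
  -- For fixed `a`, the map `r ↦ a - r` is also a bijection, so each point lies in as many intervals
  -- as an interval has points.
  simpa [cyclicInterval] using card_filter_equiv_lt n (Equiv.subLeft a)

theorem cv_nullIdeal_tukeyLE_aLc_dual {c h : ℕ → ℕ} (hc : ∀ i, 1 ≤ c i)
    (hsum : ∑' i, (h i : ℝ≥0∞) / (c i : ℝ≥0∞) < ∞) :
    RelSystem.TukeyLE (Cv nullIdeal) (aLc (finSeq c) h).dual := by
  obtain ⟨T, ν, hT, hprob, hν, hmap⟩ := exists_map_cantorMeasure_eq_infinitePi hc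
  refine ⟨T, fun φ : Slalom (finSeq c) h => ⟨{x | ¬ AntiLocalises φ (T x)}, ?_⟩,
    fun _ _ hxy => hxy⟩
  have h0 := infinitePi_frequently_eq_zero hc hν (s := fun i => (φ i).1) <|
    ne_top_of_le_ne_top hsum.ne <| ENNReal.tsum_le_tsum fun i =>
      ENNReal.div_le_div_right (Nat.cast_le.2 (φ i).2) _
  rw [← hmap] at h0
  refine measure_mono_null (fun x hx => ?_)
    -- Only an inequality for the image measure is needed, so the set need not be shown measurable.
    (nonpos_iff_eq_zero.1 ((Measure.le_map_apply hT.aemeasurable _).trans_eq h0))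
  simpa [AntiLocalises, Filter.Frequently] using hx

theorem cv_nullIdeal_tukeyLE_aLc {c h : ℕ → ℕ} (hc : ∀ i, 1 ≤ c i)
    (hsum : ∑' i, (h i : ℝ≥0∞) / (c i : ℝ≥0∞) = ∞) :
    RelSystem.TukeyLE (Cv nullIdeal) (aLc (finSeq c) h) := by
  obtain ⟨T, ν, hT, hprob, hν, hmap⟩ := exists_map_cantorMeasure_eq_infinitePi hc
  have hc0 : ∀ i, NeZero (c i) := fun i => ⟨Nat.one_le_iff_ne_zero.1 (hc i)⟩
  have hcE : ∀ i, (c i : ℝ≥0∞) ≠ 0 := fun i => Nat.cast_ne_zero.2 (NeZero.ne _)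
  let F : (ℕ → Bool) → Slalom (finSeq c) h := fun x i => cyclicInterval (h i) (T x i)
  refine ⟨F, fun y : (∀ i, Fin (c i)) => ⟨{x | AntiLocalises (F x) y}, ?_⟩, fun _ _ hxy => hxy⟩
  have h0 := infinitePi_eventually_eq_zero hν
    (s := fun i => Finset.univ.filter fun r => y i ∈ (cyclicInterval (h i) r).1) <| by
      -- An interval cannot exceed `c i` points, so the ratio is `min (h i / c i) 1`.
      rw [← tsum_min_one_eq_top hsum fun i => ENNReal.div_ne_top (by simp) (hcE i)]
      refine tsum_congr fun i => ?_
      rw [card_filter_mem_cyclicInterval, Nat.mono_cast.map_min, min_comm (c i : ℝ≥0∞),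
        ← ENNReal.div_self (hcE i) (by simp)]
      exact Monotone.map_min (f := fun t : ℝ≥0∞ => t / c i) fun _ _ hab =>
        ENNReal.div_le_div_right hab _
  rw [← hmap] at h0
  refine measure_mono_null (fun x hx => ?_)
    (nonpos_iff_eq_zero.1 ((Measure.le_map_apply hT.aemeasurable _).trans_eq h0))
  simpa [AntiLocalises, F] using hx

theorem lemma2p3 (c h : ℕ → ℕ) (hc : ∀ i, 1 ≤ c i) (hh : ∀ᶠ i in atTop, 1 ≤ h i) :
    (∑' i, (h i : ℝ≥0∞) / (c i : ℝ≥0∞) < ∞ →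
      RelSystem.TukeyLE (Cv nullIdeal) (aLc (finSeq c) h).dual ∧
      covNum nullIdeal ≤ cExists (finSeq c) h ∧
      vExists (finSeq c) h ≤ nonNum nullIdeal) ∧
    (∑' i, (h i : ℝ≥0∞) / (c i : ℝ≥0∞) = ∞ →
      RelSystem.TukeyLE (Cv nullIdeal) (aLc (finSeq c) h) ∧
      covNum nullIdeal ≤ vExists (finSeq c) h ∧
      cExists (finSeq c) h ≤ nonNum nullIdeal) := by
  have hI : ∀ A ∈ nullIdeal, ∀ B ⊆ A, B ∈ nullIdeal := fun A hA B hBA => measure_mono_null hBA hA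
  refine ⟨fun hsum => ?_, fun hsum => ?_⟩
  · have hT := cv_nullIdeal_tukeyLE_aLc_dual hc hsum
    refine ⟨hT, (covNum_le_of_tukeyLE hT).trans_eq ?_,
      le_of_eq_of_le ?_ (le_nonNum_of_tukeyLE hI hT)⟩
    -- Passing to the dual twice leaves a double negation to remove.
    · simp [cExists, aLc, RelSystem.dual]
      rfl
    · simp [vExists, aLc, RelSystem.dual]
      rfl
  · have hT := cv_nullIdeal_tukeyLE_aLc hc hsum
    exact ⟨hT, covNum_le_of_tukeyLE hT, le_nonNum_of_tukeyLE hI hT⟩
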